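/- **Setting.** All sets and functions are measurable. A *kernel* on a probability space $(S,\mu)$ is an integrable symmetric function $W:S^2\to[0,\infty)$, measurable for the product $\sigma$-field. Maps $\varphi:S'\to S$ between probability spaces are *measure preserving* if they are measurable and $\mu'(\varphi^{-1}(A))=\mu(A)$ for all measurable $A$; $W^{\varphi}(x,y)=W(\varphi(x),\varphi(y))$ is the *pull-back*. The cut norm is $\|U\|_{\square}=\sup_{A,B}\bigl|\int_{A\times B}U\,d\mu\,d\mu\bigr|$, over measurable $A,B\subseteq S$; a *coupling* of $(S_1,\mu_1)$ and $(S_2,\mu_2)$ is a pair of measure preserving maps $\varphi_j:S\to S_j$ from a common probability space $S$; $\delta_\square(W_1,W_2)=\inf\|W_1^{\varphi_1}-W_2^{\varphi_2}\|_{\square}$ over all couplings; and $W_1\cong W_2$ means $\delta_\square(W_1,W_2)=0$. Points $x_1,x_2$ are *twins* for $W$ if $W(x_1,y)=W(x_2,y)$ for a.e. $y$; $W$ is *almost twin-free* if there is a null set $N$ such that no two distinct points outside $N$ are twins. A probability space is *Borel* if its measurable space is isomorphic to a Borel subset of a Polish space, and *Lebesgue* if it is the completion of a Borel probability space. It is *atomless*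 if every $A$ with $\mu(A)>0$ has a measurable subset $B$ with $\mu(B)\notin\{0,\mu(A)\}$. The interval $[0,1]$ carries its Borel $\sigma$-field and Lebesgue measure $\lambda$ unless said otherwise. **Theorem 8.3.** Let $W_1$ and $W_2$ be kernels on Borel probability spaces $(S_1,\mu_1)$ and $(S_2,\mu_2)$. The following are equivalent. 1. $W_1\cong W_2$. 2. There is a coupling $(\varphi_1,\varphi_2)$, defined on some probability space $S$, with $W_1^{\varphi_1}=W_2^{\varphi_2}$ a.e. on $S^2$. 3. There are measure preserving maps $\varphi_j:[0,1]\to S_j$, $j=1,2$, with $W_1^{\varphi_1}=W_2^{\varphi_2}$ a.e. on $[0,1]^2$. 4. There is a measure preserving map $\psi:S_1\times[0,1]\to S_2$ such that $W_1(x,y)=W_2(\psi(x,t_1),\psi(y,t_2))$ for a.e. $x,y\in S_1$ and $t_1,t_2\in[0,1]$. 5. There is a probability measure $\mu$ on $S_1\times S_2$ with marginals $\mu_1$ and $\mu_2$ such that $W_1(x_1,y_1)=W_2(x_2,y_2)$ for $\mu\times\mu$-a.e. $((x_1,x_2),(y_1,y_2))\in(S_1\times S_2)^2$. If $W_2$ is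 almost twin-free, these are also equivalent to: 6. There is a measure preserving map $\varphi:S_1\to S_2$ with $W_1=W_2^{\varphi}$ a.e. on $S_1^2$. If both $W_1$ and $W_2$ are almost twin-free, these are also equivalent to: 7. There are a measure preserving map $\varphi:S_1\to S_2$ and null sets $N_1\subset S_1$, $N_2\subset S_2$ such that $\varphi$ restricts to a bimeasurable bijection of $S_1\setminus N_1$ onto $S_2\setminus N_2$, and $W_1=W_2^{\varphi}$ a.e. on $S_1^2$. If moreover $(S_2,\mu_2)$ is atomless, one may take $N_1=N_2=\emptyset$ in 7; that is, the conditions are then also equivalent to the existence of a bimeasurable measure preserving bijection $\varphi:S_1\to S_2$ with $W_1=W_2^{\varphi}$ a.e. ($W_1$ is, up to a.e. equality, a rearrangement of $W_2$), and to the same statement with $W_1$ and $W_2$ interchanged. The same results hold if $S_1$ and $S_2$ are both Lebesgue probability spaces, provided that in 3 $[0,1]$ carries the Lebesgue $\sigma$-field and in 4 $S_1\times[0,1]$ carries the completed $\sigma$-field. -/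

import Mathlib

open MeasureTheory Set
open scoped ENNReal unitInterval

universe u v w

/-! Kernels, pull-backs, the cut norm and the cut metric on arbitrary probability spaces. -/

/-- A kernel on the probability space `(S, μ)`: a measurable (for the product σ-field), integrable,
symmetric function `S × S → [0, ∞)`. -/
structure IsKernel {S : Type u} [MeasurableSpace S] (μ : Measure S) (W : S → S → ℝ) : Prop where
  measurable : Measurable (Function.uncurry W)
  integrable : Integrable (Function.uncurry W) (μ.prod μ)
  symm : ∀ x y, W x y = W y x
  nonneg : ∀ x y, 0 ≤ W x y

/-- The pull-back `W^φ (x, y) = W (φ x, φ y)`. -/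
def pullback {X : Type u} {S : Type v} (W : S → S → ℝ) (φ : X → S) : X → X → ℝ :=
  fun x y => W (φ x) (φ y)

/-- `V = W` almost everywhere on `X × X` with respect to `ν × ν`. -/
def EqAE {X : Type u} [MeasurableSpace X] (ν : Measure X) (V W : X → X → ℝ) : Prop :=
  ∀ᵐ p ∂(ν.prod ν), V p.1 p.2 = W p.1 p.2

/-- The cut norm `sup_{A, B} |∫_{A × B} U dμ dμ|`, the supremum over all measurable `A, B ⊆ S`. -/
noncomputable def cutNorm {S : Type u} [MeasurableSpace S] (μ : Measure S) (U : S → S → ℝ) :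
    ℝ≥0∞ :=
  ⨆ (A : Set S) (_ : MeasurableSet A) (B : Set S) (_ : MeasurableSet B),
    ENNReal.ofReal |∫ p in A ×ˢ B, U p.1 p.2 ∂(μ.prod μ)|

/-- A coupling of two probability spaces: a pair of measure preserving maps defined on a common
probability space. -/
structure Coupling {S₁ : Type u} {S₂ : Type v} [MeasurableSpace S₁] [MeasurableSpace S₂]
    (μ₁ : Measure S₁) (μ₂ : Measure S₂) where
  Ω : Type (max u v)
  [mΩ : MeasurableSpace Ω]
  P : Measure Ω
  isProb : IsProbabilityMeasure P
  φ₁ : Ω → S₁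
  φ₂ : Ω → S₂
  mp₁ : MeasurePreserving φ₁ P μ₁
  mp₂ : MeasurePreserving φ₂ P μ₂

attribute [instance] Coupling.mΩ

/-- The cut metric: the infimum of the cut norms of `W₁^{φ₁} - W₂^{φ₂}` over all couplings. -/
noncomputable def cutDist {S₁ : Type u} {S₂ : Type v} [MeasurableSpace S₁] [MeasurableSpace S₂]
    (μ₁ : Measure S₁) (W₁ : S₁ → S₁ → ℝ) (μ₂ : Measure S₂) (W₂ : S₂ → S₂ → ℝ) : ℝ≥0∞ :=
  ⨅ c : Coupling μ₁ μ₂,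
    cutNorm c.P (fun x y => pullback W₁ c.φ₁ x y - pullback W₂ c.φ₂ x y)

/-- Equivalence of kernels, `W₁ ≅ W₂`: their cut distance is zero. -/
def KernelEquiv {S₁ : Type u} {S₂ : Type v} [MeasurableSpace S₁] [MeasurableSpace S₂]
    (μ₁ : Measure S₁) (W₁ : S₁ → S₁ → ℝ) (μ₂ : Measure S₂) (W₂ : S₂ → S₂ → ℝ) : Prop :=
  cutDist μ₁ W₁ μ₂ W₂ = 0

/-! Properties of probability spaces and of kernels. -/

/-- `(S, μ)` is a Lebesgue space: its σ-field is the completion, for (the restriction of) `μ`, of a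
sub-σ-field `m₀` that makes `S` a standard Borel space. -/
def IsLebesgueSpace {S : Type u} [m : MeasurableSpace S] (μ : Measure S) : Prop :=
  ∃ (m₀ : MeasurableSpace S) (h : m₀ ≤ m), @StandardBorelSpace S m₀ ∧
    ∀ s : Set S, MeasurableSet[m] s ↔ @NullMeasurableSet S m₀ s (μ.trim h)

/-- No atoms: every measurable set of positive measure has a measurable subset whose measure is
neither zero nor that of the whole set. -/
def IsAtomless {S : Type u} [MeasurableSpace S] (μ : Measure S) : Prop :=
  ∀ A : Set S, MeasurableSet A → 0 < μ A →
    ∃ B : Set S, B ⊆ A ∧ MeasurableSet B ∧ μ B ≠ 0 ∧ μ B ≠ μ A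

/-- `x₁` and `x₂` are twins for `W`. -/
def AreTwins {S : Type u} [MeasurableSpace S] (μ : Measure S) (W : S → S → ℝ) (x₁ x₂ : S) : Prop :=
  ∀ᵐ y ∂μ, W x₁ y = W x₂ y

/-- `W` is almost twin-free. -/
def AlmostTwinFree {S : Type u} [MeasurableSpace S] (μ : Measure S) (W : S → S → ℝ) : Prop :=
  ∃ N : Set S, μ N = 0 ∧
    ¬ ∃ x₁ x₂ : S, x₁ ∉ N ∧ x₂ ∉ N ∧ x₁ ≠ x₂ ∧ AreTwins μ W x₁ x₂

/-! The relations between two kernels. -/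

/-- There are measure preserving maps `φ₁, φ₂` from the given space `(X, ν)` with
`W₁^{φ₁} = W₂^{φ₂}` a.e. -/
def HaveCommonPullbackOn {X : Type w} {S₁ : Type u} {S₂ : Type v} [MeasurableSpace X]
    [MeasurableSpace S₁] [MeasurableSpace S₂] (ν : Measure X)
    (μ₁ : Measure S₁) (W₁ : S₁ → S₁ → ℝ) (μ₂ : Measure S₂) (W₂ : S₂ → S₂ → ℝ) : Prop :=
  ∃ (φ₁ : X → S₁) (φ₂ : X → S₂), MeasurePreserving φ₁ ν μ₁ ∧ MeasurePreserving φ₂ ν μ₂ ∧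
    EqAE ν (pullback W₁ φ₁) (pullback W₂ φ₂)

/-- The function `V` on `(X, ν)` is a.e. equal to `W^φ` for some measure preserving `φ : X → S`. -/
def IsAEPullback {X : Type u} {S : Type v} [MeasurableSpace X] [MeasurableSpace S]
    (ν : Measure X) (V : X → X → ℝ) (μ : Measure S) (W : S → S → ℝ) : Prop :=
  ∃ φ : X → S, MeasurePreserving φ ν μ ∧ EqAE ν V (pullback W φ)

/-- `W₁ = W₂^φ` a.e. for some measure preserving `φ` that restricts to a bimeasurable bijection
between the complements of two null sets. -/
def IsAlmostBijectiveRearrangement {S₁ : Type u} {S₂ : Type v} [MeasurableSpace S₁]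
    [MeasurableSpace S₂] (μ₁ : Measure S₁) (W₁ : S₁ → S₁ → ℝ) (μ₂ : Measure S₂)
    (W₂ : S₂ → S₂ → ℝ) : Prop :=
  ∃ φ : S₁ → S₂, MeasurePreserving φ μ₁ μ₂ ∧
    (∃ (N₁ : Set S₁) (N₂ : Set S₂), MeasurableSet N₁ ∧ MeasurableSet N₂ ∧ μ₁ N₁ = 0 ∧ μ₂ N₂ = 0 ∧
      ∃ e : (N₁ᶜ : Set S₁) ≃ᵐ (N₂ᶜ : Set S₂), ∀ x : (N₁ᶜ : Set S₁), (e x : S₂) = φ x) ∧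
    EqAE μ₁ W₁ (pullback W₂ φ)

/-- `W₁` is an (a.e.) rearrangement of `W₂`: `W₁ = W₂^φ` a.e. for some measure preserving
bijection `φ` of `S₁` onto `S₂` with measurable inverse. -/
def IsRearrangement {S₁ : Type u} {S₂ : Type v} [MeasurableSpace S₁] [MeasurableSpace S₂]
    (μ₁ : Measure S₁) (W₁ : S₁ → S₁ → ℝ) (μ₂ : Measure S₂) (W₂ : S₂ → S₂ → ℝ) : Prop :=
  ∃ φ : S₁ ≃ᵐ S₂, MeasurePreserving φ μ₁ μ₂ ∧ EqAE μ₁ W₁ (pullback W₂ φ)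

/-- Projection to the first coordinate, on the product space `S × [0, 1]` equipped with the
completion (for the product measure) of its σ-field. -/
def completedFst {S : Type u} [MeasurableSpace S] (μ : Measure S) :
    NullMeasurableSpace (S × I) (μ.prod (volume : Measure I)) → S :=
  fun p => Prod.fst (α := S) (β := I) p

/-!
Only one implication is deep: equivalent kernels on Borel spaces agree a.e. on a suitable coupling
(`KernelEquiv.haveCouplingMeasure`). It is a compactness argument. Embed both spaces in the Cantor
space `ℕ → Bool`, where the couplings of two fixed measures form a weakly compact set, and take a
limit `Q` of couplings `P` along which the cut norm tends to zero. The integral of `W₁` over a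
clopen rectangle against `P × P` converges to the one against `Q × Q`: this is weak convergence if
`W₁` is continuous, and in general `W₁` is close in `L¹` to a continuous function, with an error
that does not depend on `P` because the marginals are fixed
(`tendsto_setIntegral_prod_of_map_eq`). The same holds for `W₂`, so the two kernels have equal
integrals over all clopen rectangles, which generate the σ-field, and hence agree `Q × Q`-a.e.
(`exists_haveCouplingMeasure_of_approx`).

Everything else is read off from the coupling measure. Every probability measure on a standard
Borel space is an image of Lebesgue measure, and the same with a parameter, applied to a
disintegration, gives a measure preserving map `ψ : S₁ × [0, 1] → S₂`. When `W₂` is almost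
twin-free, `ψ (x, t)` and `ψ (x, t')` are twins, so `ψ` does not depend on `t`
(`IsAEPullback.of_prod`). When `W₁` is almost twin-free, points with the same image under `φ` are
twins, so `φ` is injective off a null set (`AlmostTwinFree.injOn_of_eqAE`) and the Lusin–Souslin
theorem gives a measurable almost inverse. Without atoms both spaces contain uncountable Borel
null sets, and any two of these are Borel isomorphic, which repairs `φ` on the exceptional null
sets (`AlmostInverse.exists_measurableEquiv_ae_eq`). Conversely, each condition produces a
coupling by pushing forward to `S₁ × S₂`.

A Lebesgue space is the completion of a Borel space (`IsCompletionOf`), and its kernels are a.e.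
equal to Borel kernels. Since measure preserving maps into a Borel space stay measure preserving
into its completion once the source is complete, the Borel results carry over.
-/

/-! ### Couplings in general probability spaces -/

section General

variable {X : Type*} {X' : Type*} {S₁ : Type u} {S₂ : Type v} [MeasurableSpace X]
  [MeasurableSpace X'] [MeasurableSpace S₁] [MeasurableSpace S₂]

/-- Some probability measure on `S₁ × S₂` with marginals `μ₁` and `μ₂` makes the pull-backs of `W₁`
and `W₂` along the two projections a.e. equal. -/
def HaveCouplingMeasure (μ₁ : Measure S₁) (W₁ : S₁ → S₁ → ℝ) (μ₂ : Measure S₂)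
    (W₂ : S₂ → S₂ → ℝ) : Prop :=
  ∃ μ : Measure (S₁ × S₂), IsProbabilityMeasure μ ∧
    μ.map Prod.fst = μ₁ ∧ μ.map Prod.snd = μ₂ ∧
    EqAE μ (pullback W₁ Prod.fst) (pullback W₂ Prod.snd)

theorem EqAE.comp_measurePreserving {ξ : Measure X} {ξ' : Measure X'} [SFinite ξ] [SFinite ξ']
    {V W : X → X → ℝ} (h : EqAE ξ V W) {p : X' → X} (hp : MeasurePreserving p ξ' ξ) :
    EqAE ξ' (pullback V p) (pullback W p) :=
  (hp.prod hp).quasiMeasurePreserving.ae h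

theorem EqAE.symm {ξ : Measure X} {V W : X → X → ℝ} (h : EqAE ξ V W) : EqAE ξ W V := by
  filter_upwards [h] with p hp using hp.symm

theorem EqAE.trans {ξ : Measure X} {U V W : X → X → ℝ} (h : EqAE ξ U V) (h' : EqAE ξ V W) :
    EqAE ξ U W := by
  filter_upwards [h, h'] with p hp hp' using hp.trans hp'

/-- Unlike pulling back, pushing an a.e. equality forward uses the measurability of the functions.
-/
theorem EqAE.of_pullback {ξ : Measure X} {ξ' : Measure X'} [SFinite ξ] [SFinite ξ']
    {V W : X → X → ℝ} (hV : Measurable (Function.uncurry V)) (hW : Measurable (Function.uncurry W))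
    {p : X' → X} (hp : MeasurePreserving p ξ' ξ)
    (h : EqAE ξ' (pullback V p) (pullback W p)) : EqAE ξ V W := by
  unfold EqAE
  rw [← (hp.prod hp).map_eq]
  exact (ae_map_iff (hp.prod hp).measurable.aemeasurable (measurableSet_eq_fun hV hW)).2 h

theorem measurable_uncurry_pullback {W : X → X → ℝ} (hW : Measurable (Function.uncurry W))
    {p : X' → X} (hp : Measurable p) : Measurable (Function.uncurry (pullback W p)) :=
  hW.comp (hp.prodMap hp)

theorem IsKernel.pullback {ξ : Measure X} {ξ' : Measure X'} [SFinite ξ] [SFinite ξ']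
    {W : X → X → ℝ} (hW : IsKernel ξ W) {p : X' → X} (hp : MeasurePreserving p ξ' ξ) :
    IsKernel ξ' (_root_.pullback W p) where
  measurable := measurable_uncurry_pullback hW.measurable hp.measurable
  integrable := (hp.prod hp).integrable_comp_of_integrable hW.integrable
  symm _ _ := hW.symm _ _
  nonneg _ _ := hW.nonneg _ _

/-- Functions that agree a.e. have a.e. equal pull-backs. -/
theorem EqAE.pullback_of_ae_eq {ξ : Measure X} [SFinite ξ] {S : Type*} (W : S → S → ℝ)
    {φ ψ : X → S} (h : φ =ᵐ[ξ] ψ) : EqAE ξ (pullback W φ) (pullback W ψ) := by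
  have h₁ := (Measure.quasiMeasurePreserving_fst (μ := ξ) (ν := ξ)).ae h
  have h₂ := (Measure.quasiMeasurePreserving_snd (μ := ξ) (ν := ξ)).ae h
  filter_upwards [h₁, h₂] with p hp₁ hp₂
  simp [pullback, hp₁, hp₂]

/-- A common pull-back on any space is transported to `S₁ × S₂` by the joint law of the two maps. -/
theorem HaveCommonPullbackOn.haveCouplingMeasure {ν : Measure X} [IsProbabilityMeasure ν]
    {μ₁ : Measure S₁} {μ₂ : Measure S₂} {W₁ : S₁ → S₁ → ℝ} {W₂ : S₂ → S₂ → ℝ}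
    (hW₁ : Measurable (Function.uncurry W₁)) (hW₂ : Measurable (Function.uncurry W₂))
    (h : HaveCommonPullbackOn ν μ₁ W₁ μ₂ W₂) : HaveCouplingMeasure μ₁ W₁ μ₂ W₂ := by
  obtain ⟨φ₁, φ₂, h₁, h₂, h⟩ := h
  have hm : Measurable fun x => (φ₁ x, φ₂ x) := h₁.measurable.prodMk h₂.measurable
  have hP : IsProbabilityMeasure (ν.map fun x => (φ₁ x, φ₂ x)) :=
    Measure.isProbabilityMeasure_map hm.aemeasurable
  refine ⟨ν.map fun x => (φ₁ x, φ₂ x), hP, ?_, ?_, ?_⟩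
  · rw [Measure.map_map measurable_fst hm]; exact h₁.map_eq
  · rw [Measure.map_map measurable_snd hm]; exact h₂.map_eq
  · exact EqAE.of_pullback (measurable_uncurry_pullback hW₁ measurable_fst)
      (measurable_uncurry_pullback hW₂ measurable_snd) ⟨hm, rfl⟩ h

theorem HaveCouplingMeasure.exists_coupling {μ₁ : Measure S₁} {μ₂ : Measure S₂}
    {W₁ : S₁ → S₁ → ℝ} {W₂ : S₂ → S₂ → ℝ} (h : HaveCouplingMeasure μ₁ W₁ μ₂ W₂) :
    ∃ c : Coupling μ₁ μ₂, EqAE c.P (pullback W₁ c.φ₁) (pullback W₂ c.φ₂) := by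
  obtain ⟨μ, hμ, h₁, h₂, h⟩ := h
  exact ⟨⟨S₁ × S₂, μ, hμ, Prod.fst, Prod.snd, ⟨measurable_fst, h₁⟩, ⟨measurable_snd, h₂⟩⟩, h⟩

theorem kernelEquiv_of_exists_coupling {μ₁ : Measure S₁} {μ₂ : Measure S₂}
    {W₁ : S₁ → S₁ → ℝ} {W₂ : S₂ → S₂ → ℝ}
    (h : ∃ c : Coupling μ₁ μ₂, EqAE c.P (pullback W₁ c.φ₁) (pullback W₂ c.φ₂)) :
    KernelEquiv μ₁ W₁ μ₂ W₂ := by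
  obtain ⟨c, hc⟩ := h
  refine le_antisymm ((iInf_le _ c).trans ?_) bot_le
  simp only [cutNorm, iSup_le_iff]
  intro A _ B _
  have : (fun p : c.Ω × c.Ω => pullback W₁ c.φ₁ p.1 p.2 - pullback W₂ c.φ₂ p.1 p.2)
      =ᵐ[(c.P.prod c.P).restrict (A ×ˢ B)] 0 := by
    filter_upwards [ae_restrict_of_ae hc] with p hp
    simp [hp]
  rw [integral_congr_ae this]
  simp

theorem cutNorm_congr_ae {ξ : Measure X} {U V : X → X → ℝ} (h : EqAE ξ U V) :
    cutNorm ξ U = cutNorm ξ V := by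
  unfold cutNorm
  congr! 8 with A _ B _
  exact integral_congr_ae (ae_restrict_of_ae h)

theorem cutNorm_le_cutNorm_pullback {ξ : Measure X} {ξ' : Measure X'} [SFinite ξ] [SFinite ξ']
    {U : X → X → ℝ} (hU : Measurable (Function.uncurry U)) {p : X' → X}
    (hp : MeasurePreserving p ξ' ξ) : cutNorm ξ U ≤ cutNorm ξ' (pullback U p) := by
  unfold cutNorm
  simp only [iSup_le_iff]
  intro A hA B hB
  refine le_iSup₂_of_le (p ⁻¹' A) (hp.measurable hA)
    (le_iSup₂_of_le (p ⁻¹' B) (hp.measurable hB) (le_of_eq ?_))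
  have h := setIntegral_map (μ := ξ'.prod ξ') (hA.prod hB) hU.aestronglyMeasurable
    (hp.prod hp).measurable.aemeasurable
  rw [(hp.prod hp).map_eq] at h
  exact congrArg (fun t : ℝ => ENNReal.ofReal |t|) h

theorem IsAEPullback.haveCommonPullbackOn {ν : Measure X} {μ₁ : Measure S₁} {μ₂ : Measure S₂}
    {W₁ : S₁ → S₁ → ℝ} {W₂ : S₂ → S₂ → ℝ} {φ₁ : X → S₁} (h₁ : MeasurePreserving φ₁ ν μ₁)
    (h : IsAEPullback ν (pullback W₁ φ₁) μ₂ W₂) : HaveCommonPullbackOn ν μ₁ W₁ μ₂ W₂ :=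
  let ⟨φ₂, h₂, h⟩ := h
  ⟨φ₁, φ₂, h₁, h₂, h⟩

theorem IsAlmostBijectiveRearrangement.isAEPullback {μ₁ : Measure S₁} {μ₂ : Measure S₂}
    {W₁ : S₁ → S₁ → ℝ} {W₂ : S₂ → S₂ → ℝ} (h : IsAlmostBijectiveRearrangement μ₁ W₁ μ₂ W₂) :
    IsAEPullback μ₁ W₁ μ₂ W₂ :=
  let ⟨φ, h₁, _, h⟩ := h
  ⟨φ, h₁, h⟩

theorem IsRearrangement.isAEPullback {μ₁ : Measure S₁} {μ₂ : Measure S₂}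
    {W₁ : S₁ → S₁ → ℝ} {W₂ : S₂ → S₂ → ℝ} (h : IsRearrangement μ₁ W₁ μ₂ W₂) :
    IsAEPullback μ₁ W₁ μ₂ W₂ :=
  let ⟨φ, h₁, h⟩ := h
  ⟨φ, h₁, h⟩

theorem IsRearrangement.symm {μ₁ : Measure S₁} {μ₂ : Measure S₂} [SFinite μ₁] [SFinite μ₂]
    {W₁ : S₁ → S₁ → ℝ} {W₂ : S₂ → S₂ → ℝ} (h : IsRearrangement μ₁ W₁ μ₂ W₂) :
    IsRearrangement μ₂ W₂ μ₁ W₁ := by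
  obtain ⟨φ, h₁, h⟩ := h
  refine ⟨φ.symm, h₁.symm φ, ?_⟩
  have := (h.comp_measurePreserving (h₁.symm φ)).symm
  have hW : pullback (pullback W₂ φ) φ.symm = W₂ := by ext x y; simp [pullback]
  rwa [hW] at this

theorem IsAEPullback.kernelEquiv {μ₁ : Measure S₁} {μ₂ : Measure S₂} [IsProbabilityMeasure μ₁]
    {W₁ : S₁ → S₁ → ℝ} {W₂ : S₂ → S₂ → ℝ} (hW₁ : Measurable (Function.uncurry W₁))
    (hW₂ : Measurable (Function.uncurry W₂)) (h : IsAEPullback μ₁ W₁ μ₂ W₂) :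
    KernelEquiv μ₁ W₁ μ₂ W₂ := by
  have h' : HaveCommonPullbackOn μ₁ μ₁ W₁ μ₂ W₂ :=
    IsAEPullback.haveCommonPullbackOn (φ₁ := id) (MeasurePreserving.id μ₁) h
  exact kernelEquiv_of_exists_coupling (h'.haveCouplingMeasure hW₁ hW₂).exists_coupling

end General

/-! ### Weak limits of couplings -/

section Compactness

open Filter Topology

/-- Along a weakly convergent family of measures with a fixed marginal `ν`, the integral over a
clopen rectangle of any `ν × ν`-integrable function of that marginal converges. Approximating the
function in `L¹(ν × ν)` by a bounded continuous one costs an error that is uniform in the family. -/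
theorem tendsto_setIntegral_prod_of_map_eq {ι K L : Type*} {l : Filter ι}
    [TopologicalSpace K] [SecondCountableTopology K] [TopologicalSpace.PseudoMetrizableSpace K]
    [MeasurableSpace K] [BorelSpace K] [TopologicalSpace L] [SecondCountableTopology L]
    [TopologicalSpace.PseudoMetrizableSpace L] [MeasurableSpace L] [BorelSpace L]
    {P : ι → ProbabilityMeasure K} {Q : ProbabilityMeasure K} (hPQ : Tendsto P l (𝓝 Q))
    {π : K → L} (hπ : Continuous π) {ν : Measure L} [IsProbabilityMeasure ν]
    (hP : ∀ i, (P i : Measure K).map π = ν) (hQ : (Q : Measure K).map π = ν)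
    {V : L × L → ℝ} (hV : Integrable V (ν.prod ν)) {A B : Set K} (hA : IsClopen A)
    (hB : IsClopen B) :
    Tendsto (fun i => ∫ p in A ×ˢ B, V (π p.1, π p.2) ∂((P i : Measure K).prod (P i))) l
      (𝓝 (∫ p in A ×ˢ B, V (π p.1, π p.2) ∂((Q : Measure K).prod Q))) := by
  have hAB : IsClopen (A ×ˢ B) := hA.prod hB
  have hππ : Continuous fun p : K × K => (π p.1, π p.2) := by fun_prop
  have hprod : Tendsto (fun i => (P i).prod (P i)) l (𝓝 (Q.prod Q)) :=
    (ProbabilityMeasure.continuous_prod.tendsto (Q, Q)).comp (hPQ.prodMk_nhds hPQ)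
  have key : ∀ R : ProbabilityMeasure K, (R : Measure K).map π = ν →
      ∀ (h : BoundedContinuousFunction (L × L) ℝ), Integrable h (ν.prod ν) →
      |(∫ p in A ×ˢ B, V (π p.1, π p.2) ∂((R : Measure K).prod R)) -
        ∫ p in A ×ˢ B, h (π p.1, π p.2) ∂((R : Measure K).prod R)| ≤
      ∫ x, ‖V x - h x‖ ∂(ν.prod ν) := by
    intro R hR h hh
    have mp : MeasurePreserving (fun p : K × K => (π p.1, π p.2)) ((R : Measure K).prod R)
        (ν.prod ν) :=
      MeasurePreserving.prod ⟨hπ.measurable, hR⟩ ⟨hπ.measurable, hR⟩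
    have i₁ := mp.integrable_comp_of_integrable hV
    have i₂ := mp.integrable_comp_of_integrable hh
    have i₃ := mp.integrable_comp_of_integrable (hV.sub hh).norm
    have hsub := integral_sub (i₁.integrableOn (s := A ×ˢ B)) (i₂.integrableOn (s := A ×ˢ B))
    simp only [Function.comp_apply] at hsub
    rw [← hsub, ← Real.norm_eq_abs]
    refine (norm_integral_le_integral_norm _).trans ?_
    refine (setIntegral_le_integral i₃ (ae_of_all _ fun _ => norm_nonneg _)).trans ?_
    rw [← mp.map_eq, integral_map mp.measurable.aemeasurable]
    · rfl
    · rw [mp.map_eq]; exact (hV.sub hh).norm.aestronglyMeasurable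
  rw [Metric.tendsto_nhds]
  intro ε hε
  obtain ⟨h, hle, hint⟩ := hV.exists_boundedContinuous_integral_sub_le (ε := ε / 4) (by linarith)
  -- The indicator of a clopen set is continuous, so it can be absorbed into the test function.
  let g : BoundedContinuousFunction (K × K) ℝ :=
    BoundedContinuousFunction.ofNormedAddCommGroup
      ((A ×ˢ B).indicator fun p => h (π p.1, π p.2))
      ((h.continuous.comp hππ).indicator fun _ hp => by simp [hAB.frontier_eq] at hp) ‖h‖
      (fun p => (norm_indicator_le_norm_self _ _).trans (h.norm_coe_le_norm _))
  have hg : ∀ R : ProbabilityMeasure K, ∫ p, g p ∂((R.prod R : ProbabilityMeasure (K × K)) :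
      Measure (K × K)) = ∫ p in A ×ˢ B, h (π p.1, π p.2) ∂((R : Measure K).prod R) := by
    intro R
    rw [← integral_indicator hAB.2.measurableSet]
    rfl
  have ht := (ProbabilityMeasure.tendsto_iff_forall_integral_tendsto.1 hprod) g
  rw [Metric.tendsto_nhds] at ht
  filter_upwards [ht (ε / 4) (by linarith)] with i hi
  rw [hg, hg, Real.dist_eq] at hi
  rw [Real.dist_eq]
  have a₁ := abs_le.1 ((key (P i) (hP i) h hint).trans hle)
  have a₂ := abs_le.1 ((key Q hQ h hint).trans hle)
  have a₃ := abs_lt.1 hi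
  rw [abs_lt]
  constructor <;> linarith [a₁.1, a₁.2, a₂.1, a₂.2, a₃.1, a₃.2]

/-- Two nonnegative integrable functions with equal integrals over all clopen rectangles of a
totally disconnected compact metrizable space are a.e. equal. -/
theorem ae_eq_of_forall_setIntegral_isClopen_prod {K : Type*} [TopologicalSpace K]
    [CompactSpace K] [T2Space K] [TotallyDisconnectedSpace K] [SecondCountableTopology K]
    [MeasurableSpace K] [BorelSpace K] {ρ : Measure (K × K)} [IsFiniteMeasure ρ]
    {f g : K × K → ℝ} (hf : Integrable f ρ) (hg : Integrable g ρ) (hf₀ : 0 ≤ f) (hg₀ : 0 ≤ g)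
    (h : ∀ A B : Set K, IsClopen A → IsClopen B →
      ∫ p in A ×ˢ B, f p ∂ρ = ∫ p in A ×ˢ B, g p ∂ρ) : f =ᵐ[ρ] g := by
  have hf' : AEMeasurable (fun p => ENNReal.ofReal (f p)) ρ :=
    hf.aestronglyMeasurable.aemeasurable.ennreal_ofReal
  have hg' : AEMeasurable (fun p => ENNReal.ofReal (g p)) ρ :=
    hg.aestronglyMeasurable.aemeasurable.ennreal_ofReal
  have hfin : ∫⁻ p, ENNReal.ofReal (f p) ∂ρ ≠ ∞ := by
    rw [← ofReal_integral_eq_lintegral_ofReal hf (ae_of_all _ hf₀)]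
    exact ENNReal.ofReal_ne_top
  have := isFiniteMeasure_withDensity hfin
  have hrect : ∀ A B : Set K, IsClopen A → IsClopen B →
      ρ.withDensity (fun p => ENNReal.ofReal (f p)) (A ×ˢ B) =
      ρ.withDensity (fun p => ENNReal.ofReal (g p)) (A ×ˢ B) := by
    intro A B hA hB
    have hm : MeasurableSet (A ×ˢ B) := hA.2.measurableSet.prod hB.2.measurableSet
    rw [withDensity_apply _ hm, withDensity_apply _ hm,
      ← ofReal_integral_eq_lintegral_ofReal hf.integrableOn (ae_of_all _ hf₀),
      ← ofReal_integral_eq_lintegral_ofReal hg.integrableOn (ae_of_all _ hg₀), h A B hA hB]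
  have hgen : MeasurableSpace.generateFrom {s : Set K | IsClopen s} = ‹MeasurableSpace K› := by
    rw [← isTopologicalBasis_isClopen.borel_eq_generateFrom]
    exact BorelSpace.measurable_eq.symm
  have hspan : IsCountablySpanning {s : Set K | IsClopen s} :=
    ⟨fun _ => univ, fun _ => isClopen_univ, iUnion_const univ⟩
  have hpi : IsPiSystem {s : Set K | IsClopen s} := fun _ hs _ ht _ => hs.inter ht
  have heq : ρ.withDensity (fun p => ENNReal.ofReal (f p)) =
      ρ.withDensity (fun p => ENNReal.ofReal (g p)) := by
    refine ext_of_generate_finite _ (generateFrom_eq_prod hgen hgen hspan hspan).symm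
      (hpi.prod hpi) ?_ ?_
    · rintro _ ⟨A, hA, B, hB, rfl⟩
      exact hrect A B hA hB
    · rw [← univ_prod_univ]
      exact hrect _ _ isClopen_univ isClopen_univ
  filter_upwards [(withDensity_eq_iff hf' hg' hfin).1 heq] with p hp
  exact (ENNReal.ofReal_eq_ofReal_iff (hf₀ p) (hg₀ p)).1 hp

/-- On a totally disconnected compact metrizable space, couplings along which the cut norm of the
difference of two kernels tends to zero accumulate at a coupling where the kernels agree. -/
theorem exists_haveCouplingMeasure_of_approx {K : Type*} [TopologicalSpace K]
    [CompactSpace K] [TopologicalSpace.MetrizableSpace K] [TotallyDisconnectedSpace K]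
    [SecondCountableTopology K] [MeasurableSpace K] [BorelSpace K] {ν₁ ν₂ : Measure K}
    [IsProbabilityMeasure ν₁] [IsProbabilityMeasure ν₂] {V₁ V₂ : K → K → ℝ}
    (hV₁ : IsKernel ν₁ V₁) (hV₂ : IsKernel ν₂ V₂)
    (h : ∀ ε : ℝ, 0 < ε → ∃ P : Measure (K × K), IsProbabilityMeasure P ∧
      P.map Prod.fst = ν₁ ∧ P.map Prod.snd = ν₂ ∧
      cutNorm P (fun x y => pullback V₁ Prod.fst x y - pullback V₂ Prod.snd x y)
        ≤ ENNReal.ofReal ε) :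
    HaveCouplingMeasure ν₁ V₁ ν₂ V₂ := by
  have := fun n : ℕ => h (1 / ((n : ℝ) + 1)) (by positivity)
  choose P hP hP₁ hP₂ hcut using this
  let P' : ℕ → ProbabilityMeasure (K × K) := fun n => ⟨P n, hP n⟩
  -- An ultrafilter spares the extraction of a convergent subsequence.
  let l : Ultrafilter ℕ := Filter.hyperfilter ℕ
  have hl : (l : Filter ℕ) ≤ atTop := Nat.hyperfilter_le_atTop
  let Q : ProbabilityMeasure (K × K) := (l.map P').lim
  have hQ : Tendsto P' l (𝓝 Q) := (l.map P').le_nhds_lim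
  have hmap : ∀ {π : K × K → K} {ν : Measure K} [IsProbabilityMeasure ν], Continuous π →
      (∀ n, (P n).map π = ν) → (Q : Measure (K × K)).map π = ν := by
    intro π ν hν hπ hPn
    have h₁ := ProbabilityMeasure.tendsto_map_of_tendsto_of_continuous P' Q hQ hπ
    have h₂ : (fun n => (P' n).map hπ.measurable.aemeasurable) =
        fun _ => (⟨ν, hν⟩ : ProbabilityMeasure K) := by
      funext n
      exact Subtype.ext (hPn n)
    rw [h₂] at h₁
    have h₃ := tendsto_nhds_unique h₁ tendsto_const_nhds
    exact congrArg (fun R : ProbabilityMeasure K => (R : Measure K)) h₃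
  have hQ₁ := hmap continuous_fst hP₁
  have hQ₂ := hmap continuous_snd hP₂
  have mp : ∀ {π : K × K → K} {ν : Measure K} {R : Measure (K × K)} [IsProbabilityMeasure R],
      IsProbabilityMeasure ν → Continuous π → R.map π = ν →
      MeasurePreserving (fun p : (K × K) × (K × K) => (π p.1, π p.2)) (R.prod R) (ν.prod ν) :=
    fun _ hπ hR => MeasurePreserving.prod ⟨hπ.measurable, hR⟩ ⟨hπ.measurable, hR⟩
  refine ⟨Q, inferInstance, hQ₁, hQ₂, ?_⟩
  refine ae_eq_of_forall_setIntegral_isClopen_prod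
    ((mp inferInstance continuous_fst hQ₁).integrable_comp_of_integrable hV₁.integrable)
    ((mp inferInstance continuous_snd hQ₂).integrable_comp_of_integrable hV₂.integrable)
    (fun p => hV₁.nonneg _ _) (fun p => hV₂.nonneg _ _) fun A B hA hB => ?_
  have t₁ := tendsto_setIntegral_prod_of_map_eq hQ continuous_fst hP₁ hQ₁ hV₁.integrable hA hB
  have t₂ := tendsto_setIntegral_prod_of_map_eq hQ continuous_snd hP₂ hQ₂ hV₂.integrable hA hB
  have hsmall : Tendsto (fun n => (∫ p in A ×ˢ B, Function.uncurry V₁ (p.1.1, p.2.1)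
      ∂((P' n : Measure (K × K)).prod (P' n))) -
      ∫ p in A ×ˢ B, Function.uncurry V₂ (p.1.2, p.2.2)
      ∂((P' n : Measure (K × K)).prod (P' n))) l (𝓝 0) := by
    refine squeeze_zero_norm (fun n => ?_) (tendsto_one_div_add_atTop_nhds_zero_nat.mono_left hl)
    have i₁ := (mp inferInstance continuous_fst (hP₁ n)).integrable_comp_of_integrable
      hV₁.integrable
    have i₂ := (mp inferInstance continuous_snd (hP₂ n)).integrable_comp_of_integrable
      hV₂.integrable
    have hle : ENNReal.ofReal |∫ p in A ×ˢ B, (pullback V₁ Prod.fst p.1 p.2 -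
        pullback V₂ Prod.snd p.1 p.2) ∂((P n).prod (P n))| ≤
        ENNReal.ofReal (1 / ((n : ℝ) + 1)) := by
      refine le_trans ?_ (hcut n)
      unfold cutNorm
      exact le_iSup₂_of_le A hA.2.measurableSet (le_iSup₂_of_le B hB.2.measurableSet le_rfl)
    rw [ENNReal.ofReal_le_ofReal_iff (by positivity)] at hle
    refine le_trans (le_of_eq ?_) hle
    rw [Real.norm_eq_abs]
    congr 1
    exact (integral_sub i₁.integrableOn i₂.integrableOn).symm
  exact sub_eq_zero.1 (tendsto_nhds_unique (t₁.sub t₂) hsmall)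

end Compactness

/-! ### Attaining the cut distance zero -/

section Borel

/-- A standard Borel probability space embeds in the Cantor space, with a measurable retraction. -/
theorem exists_measurable_leftInverse_cantor (T : Type*) [MeasurableSpace T] [StandardBorelSpace T]
    [Nonempty T] :
    ∃ (i : T → ℕ → Bool) (r : (ℕ → Bool) → T), Measurable i ∧ Measurable r ∧ ∀ x, r (i x) = x := by
  have hi : MeasurableEmbedding (MeasurableSpace.mapNatBool T) :=
    (MeasurableSpace.measurable_mapNatBool T).measurableEmbedding
      (MeasurableSpace.injective_mapNatBool T)
  obtain ⟨r, hr, hri⟩ := hi.exists_measurable_extend measurable_id fun _ => inferInstance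
  exact ⟨_, r, hi.measurable, hr, congrFun hri⟩

/-- Equivalent kernels that factor through standard Borel spaces have a coupling on which the
factored kernels agree a.e. The factor maps `p₁`, `p₂` are identities for Borel spaces; for Lebesgue
spaces they pass to the underlying Borel spaces. -/
theorem KernelEquiv.haveCouplingMeasure {S₁ : Type u} {S₂ : Type v} {T₁ T₂ : Type*}
    [MeasurableSpace S₁] [MeasurableSpace S₂] [MeasurableSpace T₁] [MeasurableSpace T₂]
    [StandardBorelSpace T₁] [StandardBorelSpace T₂] {μ₁ : Measure S₁} {μ₂ : Measure S₂}
    {ν₁ : Measure T₁} {ν₂ : Measure T₂} [IsProbabilityMeasure μ₁] [IsProbabilityMeasure μ₂]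
    [IsProbabilityMeasure ν₁] [IsProbabilityMeasure ν₂] {W₁ : S₁ → S₁ → ℝ} {W₂ : S₂ → S₂ → ℝ}
    {V₁ : T₁ → T₁ → ℝ} {V₂ : T₂ → T₂ → ℝ} (hV₁ : IsKernel ν₁ V₁) (hV₂ : IsKernel ν₂ V₂)
    {p₁ : S₁ → T₁} {p₂ : S₂ → T₂} (hp₁ : MeasurePreserving p₁ μ₁ ν₁)
    (hp₂ : MeasurePreserving p₂ μ₂ ν₂) (h₁ : EqAE μ₁ W₁ (pullback V₁ p₁))
    (h₂ : EqAE μ₂ W₂ (pullback V₂ p₂)) (h : KernelEquiv μ₁ W₁ μ₂ W₂) :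
    HaveCouplingMeasure ν₁ V₁ ν₂ V₂ := by
  have : Nonempty T₁ := nonempty_of_isProbabilityMeasure ν₁
  have : Nonempty T₂ := nonempty_of_isProbabilityMeasure ν₂
  obtain ⟨i₁, r₁, hi₁, hr₁, hri₁⟩ := exists_measurable_leftInverse_cantor T₁
  obtain ⟨i₂, r₂, hi₂, hr₂, hri₂⟩ := exists_measurable_leftInverse_cantor T₂
  have : IsProbabilityMeasure (ν₁.map i₁) := Measure.isProbabilityMeasure_map hi₁.aemeasurable
  have : IsProbabilityMeasure (ν₂.map i₂) := Measure.isProbabilityMeasure_map hi₂.aemeasurable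
  have mr₁ : MeasurePreserving r₁ (ν₁.map i₁) ν₁ := ⟨hr₁, by
    rw [Measure.map_map hr₁ hi₁, show r₁ ∘ i₁ = id from funext hri₁, Measure.map_id]⟩
  have mr₂ : MeasurePreserving r₂ (ν₂.map i₂) ν₂ := ⟨hr₂, by
    rw [Measure.map_map hr₂ hi₂, show r₂ ∘ i₂ = id from funext hri₂, Measure.map_id]⟩
  have key : HaveCouplingMeasure (ν₁.map i₁) (pullback V₁ r₁) (ν₂.map i₂) (pullback V₂ r₂) := by
    refine exists_haveCouplingMeasure_of_approx (hV₁.pullback mr₁) (hV₂.pullback mr₂)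
      fun ε hε => ?_
    have hlt : cutDist μ₁ W₁ μ₂ W₂ < ENNReal.ofReal ε := by
      rw [show cutDist μ₁ W₁ μ₂ W₂ = 0 from h]
      exact ENNReal.ofReal_pos.2 hε
    obtain ⟨c, hc⟩ := iInf_lt_iff.1 hlt
    have := c.isProb
    have m₁ : MeasurePreserving (fun x => i₁ (p₁ (c.φ₁ x))) c.P (ν₁.map i₁) :=
      MeasurePreserving.comp ⟨hi₁, rfl⟩ (hp₁.comp c.mp₁)
    have m₂ : MeasurePreserving (fun x => i₂ (p₂ (c.φ₂ x))) c.P (ν₂.map i₂) :=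
      MeasurePreserving.comp ⟨hi₂, rfl⟩ (hp₂.comp c.mp₂)
    have hm := m₁.measurable.prodMk m₂.measurable
    have : IsProbabilityMeasure (c.P.map fun x => (i₁ (p₁ (c.φ₁ x)), i₂ (p₂ (c.φ₂ x)))) :=
      Measure.isProbabilityMeasure_map hm.aemeasurable
    refine ⟨c.P.map fun x => (i₁ (p₁ (c.φ₁ x)), i₂ (p₂ (c.φ₂ x))), this, ?_, ?_, ?_⟩
    · rw [Measure.map_map measurable_fst hm]; exact m₁.map_eq
    · rw [Measure.map_map measurable_snd hm]; exact m₂.map_eq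
    · refine (cutNorm_le_cutNorm_pullback ?_ ⟨hm, rfl⟩).trans (le_trans (le_of_eq ?_) hc.le)
      · exact (measurable_uncurry_pullback (hV₁.pullback mr₁).measurable measurable_fst).sub
          (measurable_uncurry_pullback (hV₂.pullback mr₂).measurable measurable_snd)
      · refine cutNorm_congr_ae ?_
        filter_upwards [h₁.comp_measurePreserving c.mp₁, h₂.comp_measurePreserving c.mp₂]
          with x hx₁ hx₂
        simp only [pullback] at hx₁ hx₂ ⊢
        simp only [hri₁, hri₂, hx₁, hx₂]
  obtain ⟨P, hP, hP₁, hP₂, hP₃⟩ := key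
  exact HaveCommonPullbackOn.haveCouplingMeasure (ν := P) hV₁.measurable hV₂.measurable
    ⟨r₁ ∘ Prod.fst, r₂ ∘ Prod.snd, mr₁.comp ⟨measurable_fst, hP₁⟩,
      mr₂.comp ⟨measurable_snd, hP₂⟩, hP₃⟩

variable {S₁ S₂ : Type*} [MeasurableSpace S₁] [MeasurableSpace S₂]
  {μ₁ : Measure S₁} {μ₂ : Measure S₂} [IsProbabilityMeasure μ₁] [IsProbabilityMeasure μ₂]
  {W₁ : S₁ → S₁ → ℝ} {W₂ : S₂ → S₂ → ℝ}

/-! ### Couplings over the unit interval -/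

omit [IsProbabilityMeasure μ₁] [IsProbabilityMeasure μ₂] in
theorem HaveCouplingMeasure.haveCommonPullbackOn_unitInterval [StandardBorelSpace S₁]
    [StandardBorelSpace S₂] (h : HaveCouplingMeasure μ₁ W₁ μ₂ W₂) :
    HaveCommonPullbackOn (volume : Measure I) μ₁ W₁ μ₂ W₂ := by
  obtain ⟨μ, hμ, h₁, h₂, h⟩ := h
  have : Nonempty (S₁ × S₂) := nonempty_of_isProbabilityMeasure μ
  obtain ⟨f, hf, hfμ⟩ := μ.exists_measurable_map_eq
  have mf : MeasurePreserving f volume μ := ⟨hf, hfμ⟩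
  exact ⟨Prod.fst ∘ f, Prod.snd ∘ f, MeasurePreserving.comp ⟨measurable_fst, h₁⟩ mf,
    MeasurePreserving.comp ⟨measurable_snd, h₂⟩ mf, h.comp_measurePreserving mf⟩

/-- A coupling measure disintegrates over `S₁`, and a uniform variable realises the conditional
laws. -/
theorem HaveCouplingMeasure.isAEPullback_prod_unitInterval [StandardBorelSpace S₂]
    (h : HaveCouplingMeasure μ₁ W₁ μ₂ W₂) :
    IsAEPullback (μ₁.prod (volume : Measure I)) (pullback W₁ Prod.fst) μ₂ W₂ := by
  obtain ⟨μ, hμ, h₁, h₂, h⟩ := h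
  have : Nonempty S₂ := nonempty_of_isProbabilityMeasure μ₂
  obtain ⟨f, hf, hfκ⟩ := μ.condKernel.exists_measurable_map_eq_unitInterval
  have hF : Measurable fun q : S₁ × I => (q.1, f q.1 q.2) := measurable_fst.prodMk hf
  have mF : MeasurePreserving (fun q : S₁ × I => (q.1, f q.1 q.2)) (μ₁.prod volume) μ := by
    refine ⟨hF, ?_⟩
    have hfst : μ.fst = μ₁ := h₁
    rw [← μ.disintegrate μ.condKernel, hfst]
    ext s hs
    rw [Measure.map_apply hF hs, Measure.prod_apply (hF hs), Measure.compProd_apply hs]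
    refine lintegral_congr fun x => ?_
    rw [← hfκ x, Measure.map_apply hf.of_uncurry_left (measurable_prodMk_left hs)]
    rfl
  exact ⟨fun q => f q.1 q.2, MeasurePreserving.comp ⟨measurable_snd, h₂⟩ mF,
    h.comp_measurePreserving mF⟩

/-! ### Twin-free kernels -/

omit [IsProbabilityMeasure μ₂] in
/-- If `W₂` is almost twin-free, the map `ψ` of a representation
`W₁ (x, y) = W₂ (ψ (x, t), ψ (y, s))` hardly depends on the second variable:
`ψ (x, t)` and `ψ (x, t')` are twins. -/
theorem IsAEPullback.of_prod {X : Type*} [MeasurableSpace X] {ξ : Measure X}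
    [IsProbabilityMeasure ξ] (hW₁ : Measurable (Function.uncurry W₁))
    (hW₂ : Measurable (Function.uncurry W₂)) (htf : AlmostTwinFree μ₂ W₂)
    (h : IsAEPullback (μ₁.prod ξ) (pullback W₁ Prod.fst) μ₂ W₂) : IsAEPullback μ₁ W₁ μ₂ W₂ := by
  obtain ⟨ψ, hψ, h⟩ := h
  obtain ⟨N, hN, htf⟩ := htf
  let good : S₁ × X → Prop := fun p =>
    ψ p ∉ N ∧ ∀ᵐ q ∂(μ₁.prod ξ), W₁ p.1 q.1 = W₂ (ψ p) (ψ q)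
  have hgood : ∀ᵐ p ∂(μ₁.prod ξ), good p :=
    (hψ.quasiMeasurePreserving.ae (measure_eq_zero_iff_ae_notMem.1 hN)).and
      (Measure.ae_ae_of_ae_prod h)
  have htwin : ∀ p p', good p → good p' → p.1 = p'.1 → ψ p = ψ p' := by
    intro p p' hp hp' hpp'
    by_contra hne
    refine htf ⟨ψ p, ψ p', hp.1, hp'.1, hne, ?_⟩
    have hms : MeasurableSet {y | W₂ (ψ p) y = W₂ (ψ p') y} :=
      measurableSet_eq_fun (hW₂.comp measurable_prodMk_left) (hW₂.comp measurable_prodMk_left)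
    have hq : ∀ᵐ q ∂(μ₁.prod ξ), W₂ (ψ p) (ψ q) = W₂ (ψ p') (ψ q) := by
      filter_upwards [hp.2, hp'.2] with q h₁ h₂
      rw [← h₁, ← h₂, hpp']
    unfold AreTwins
    rw [← hψ.map_eq]
    exact (ae_map_iff hψ.measurable.aemeasurable hms).2 hq
  obtain ⟨t, ht⟩ := (Measure.ae_ae_of_ae_prod
    ((Measure.measurePreserving_swap (μ := ξ) (ν := μ₁)).quasiMeasurePreserving.ae hgood)).exists
  have hφm : Measurable fun x => ψ (x, t) := hψ.measurable.comp measurable_prodMk_right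
  have hφ : ψ =ᵐ[μ₁.prod ξ] fun p => ψ (p.1, t) := by
    filter_upwards [hgood, (Measure.quasiMeasurePreserving_fst (μ := μ₁) (ν := ξ)).ae ht]
      with p hp hp'
    exact htwin p (p.1, t) hp hp' rfl
  have mfst : MeasurePreserving Prod.fst (μ₁.prod ξ) μ₁ := measurePreserving_fst
  refine ⟨fun x => ψ (x, t), ⟨hφm, ?_⟩, ?_⟩
  · rw [← hψ.map_eq, Measure.map_congr hφ, ← mfst.map_eq, Measure.map_map hφm measurable_fst,
      mfst.map_eq]
    rfl
  · exact EqAE.of_pullback hW₁ (measurable_uncurry_pullback hW₂ hφm) mfst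
      (h.trans (EqAE.pullback_of_ae_eq W₂ hφ))

omit [MeasurableSpace S₂] in
/-- If `W₁` is almost twin-free, a map `φ` with `W₁ = W₂^φ` a.e. is injective off a null set, since
points with the same image are twins. -/
theorem AlmostTwinFree.injOn_of_eqAE {φ : S₁ → S₂} (htf : AlmostTwinFree μ₁ W₁)
    (h : EqAE μ₁ W₁ (pullback W₂ φ)) :
    ∃ C : Set S₁, MeasurableSet C ∧ μ₁ Cᶜ = 0 ∧ InjOn φ C := by
  obtain ⟨N, hN, htf⟩ := htf
  have hgood : ∀ᵐ x ∂μ₁, x ∉ N ∧ ∀ᵐ y ∂μ₁, W₁ x y = W₂ (φ x) (φ y) :=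
    (measure_eq_zero_iff_ae_notMem.1 hN).and (Measure.ae_ae_of_ae_prod h)
  obtain ⟨M, hM, hMm, hM₀⟩ := exists_measurable_superset_of_null hgood
  refine ⟨Mᶜ, hMm.compl, by rwa [compl_compl], fun x hx x' hx' hxx' => ?_⟩
  have hx := not_not.1 fun hn => hx (hM hn)
  have hx' := not_not.1 fun hn => hx' (hM hn)
  by_contra hne
  refine htf ⟨x, x', hx.1, hx'.1, hne, ?_⟩
  filter_upwards [hx.2, hx'.2] with y h₁ h₂
  rw [h₁, h₂, hxx']

/-! ### Almost bijective maps -/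

/-- `φ` and `g` are measure preserving and restrict to mutually inverse maps between the complements
of the measurable null sets `N₁` and `N₂`. Keeping a globally defined almost inverse `g` makes the
notion easy to transport to other σ-fields. -/
structure AlmostInverse (μ₁ : Measure S₁) (μ₂ : Measure S₂) (φ : S₁ → S₂) (g : S₂ → S₁)
    (N₁ : Set S₁) (N₂ : Set S₂) : Prop where
  mp : MeasurePreserving φ μ₁ μ₂
  mp_inv : MeasurePreserving g μ₂ μ₁
  measurableSet₁ : MeasurableSet N₁
  measurableSet₂ : MeasurableSet N₂
  null₁ : μ₁ N₁ = 0
  null₂ : μ₂ N₂ = 0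
  mapsTo : MapsTo φ N₁ᶜ N₂ᶜ
  mapsTo_inv : MapsTo g N₂ᶜ N₁ᶜ
  invOn : InvOn g φ N₁ᶜ N₂ᶜ

omit [IsProbabilityMeasure μ₁] [IsProbabilityMeasure μ₂] in
theorem AlmostInverse.exists_measurableEquiv {φ : S₁ → S₂} {g : S₂ → S₁} {N₁ : Set S₁}
    {N₂ : Set S₂} (h : AlmostInverse μ₁ μ₂ φ g N₁ N₂) :
    ∃ e : (N₁ᶜ : Set S₁) ≃ᵐ (N₂ᶜ : Set S₂), ∀ x : (N₁ᶜ : Set S₁), (e x : S₂) = φ x :=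
  ⟨{ toFun := fun x => ⟨φ x, h.mapsTo x.2⟩
     invFun := fun y => ⟨g y, h.mapsTo_inv y.2⟩
     left_inv := fun x => Subtype.ext (h.invOn.1 x.2)
     right_inv := fun y => Subtype.ext (h.invOn.2 y.2)
     measurable_toFun := (h.mp.measurable.comp measurable_subtype_coe).subtype_mk
     measurable_invFun := (h.mp_inv.measurable.comp measurable_subtype_coe).subtype_mk },
    fun _ => rfl⟩

omit [IsProbabilityMeasure μ₁] [IsProbabilityMeasure μ₂] in
theorem AlmostInverse.isAlmostBijectiveRearrangement {φ : S₁ → S₂} {g : S₂ → S₁} {N₁ : Set S₁}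
    {N₂ : Set S₂} (h : AlmostInverse μ₁ μ₂ φ g N₁ N₂) (hW : EqAE μ₁ W₁ (pullback W₂ φ)) :
    IsAlmostBijectiveRearrangement μ₁ W₁ μ₂ W₂ :=
  ⟨φ, h.mp, ⟨N₁, N₂, h.measurableSet₁, h.measurableSet₂, h.null₁, h.null₂,
    h.exists_measurableEquiv⟩, hW⟩

omit [IsProbabilityMeasure μ₂] in
/-- By the Lusin–Souslin theorem, a measure preserving map between standard Borel spaces that is
injective off a null set has an almost inverse. -/
theorem exists_almostInverse [StandardBorelSpace S₁] [StandardBorelSpace S₂] {φ : S₁ → S₂}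
    (hφ : MeasurePreserving φ μ₁ μ₂) {C : Set S₁} (hC : MeasurableSet C) (hC₀ : μ₁ Cᶜ = 0)
    (hinj : InjOn φ C) :
    ∃ g N₁ N₂, AlmostInverse μ₁ μ₂ φ g N₁ N₂ := by
  have := hC.standardBorel
  have : Nonempty S₁ := nonempty_of_isProbabilityMeasure μ₁
  have hemb : MeasurableEmbedding (C.domRestrict φ) :=
    (hφ.measurable.comp measurable_subtype_coe).measurableEmbedding hinj.injective
  obtain ⟨g, hg, hgφ⟩ := hemb.exists_measurable_extend measurable_subtype_coe
    fun _ => inferInstance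
  have hinv : ∀ x ∈ C, g (φ x) = x := fun x hx => congrFun hgφ ⟨x, hx⟩
  have hIm : MeasurableSet (φ '' C) := hC.image_of_measurable_injOn hφ.measurable hinj
  have hae : g ∘ φ =ᵐ[μ₁] id := by
    filter_upwards [measure_eq_zero_iff_ae_notMem.1 hC₀] with x hx
    exact hinv x (not_not.1 hx)
  refine ⟨g, Cᶜ, (φ '' C)ᶜ, hφ, ⟨hg, ?_⟩, hC.compl, hIm.compl, hC₀, ?_, ?_, ?_, ?_, ?_⟩
  · rw [← hφ.map_eq, Measure.map_map hg hφ.measurable, Measure.map_congr hae, Measure.map_id]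
  · rw [← hφ.measure_preimage hIm.compl.nullMeasurableSet]
    exact measure_mono_null (fun x hx hxC => hx ⟨x, hxC, rfl⟩) hC₀
  · rw [compl_compl, compl_compl]; exact mapsTo_image φ C
  · rw [compl_compl, compl_compl]
    rintro _ ⟨x, hx, rfl⟩
    rwa [hinv x hx]
  · rw [compl_compl]; exact hinv
  · rw [compl_compl]
    rintro _ ⟨x, hx, rfl⟩
    rw [hinv x hx]

/-- Identify the space with the plane: among the uncountably many disjoint vertical lines, only
countably many have positive measure. -/
theorem exists_uncountable_null [StandardBorelSpace S₁] (hS : ¬ Countable S₁) :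
    ∃ Z : Set S₁, MeasurableSet Z ∧ μ₁ Z = 0 ∧ ¬ Countable Z := by
  have hR : ¬ Countable ℝ := not_countable
  have hRR : ¬ Countable (ℝ × ℝ) := not_countable
  let e : S₁ ≃ᵐ ℝ × ℝ := PolishSpace.measurableEquivOfNotCountable hS hRR
  let F : ℝ → Set S₁ := fun a => (fun x => (e x).1) ⁻¹' {a}
  have hF : ∀ a, MeasurableSet (F a) := fun a =>
    measurable_fst.comp e.measurable (measurableSet_singleton a)
  have hdisj : Pairwise (Function.onFun Disjoint F) := fun a b hab =>
    (disjoint_singleton.2 hab).preimage _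
  have hc := Measure.countable_meas_pos_of_disjoint_iUnion (μ := μ₁) hF hdisj
  obtain ⟨a, ha⟩ : ∃ a, a ∉ {a | 0 < μ₁ (F a)} := by
    by_contra! hall
    exact hR (countable_univ_iff.1 (hc.mono fun a _ => hall a))
  refine ⟨F a, hF a, by simpa using ha, fun hcount => hR ?_⟩
  have : Function.Injective fun b : ℝ => (⟨e.symm (a, b), by simp [F]⟩ : F a) := by
    intro b b' hbb'
    have := e.symm.injective (Subtype.ext_iff.1 hbb')
    exact (Prod.mk.inj this).2
  exact this.countable

/-- Without atoms an almost bijective map can be completed to a bijection: after enlarging the two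
exceptional null sets by uncountable ones, they are Borel isomorphic. -/
theorem AlmostInverse.exists_measurableEquiv_ae_eq [StandardBorelSpace S₁] [StandardBorelSpace S₂]
    {φ : S₁ → S₂} {g : S₂ → S₁} {N₁ : Set S₁} {N₂ : Set S₂}
    (h : AlmostInverse μ₁ μ₂ φ g N₁ N₂) (hatom : ∀ y, μ₂ {y} = 0) :
    ∃ e : S₁ ≃ᵐ S₂, ⇑e =ᵐ[μ₁] φ := by
  classical
  have hS₂ : ¬ Countable S₂ := by
    intro hc
    have : μ₂ univ = 0 := by
      rw [← biUnion_of_singleton univ]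
      exact (measure_biUnion_null_iff (to_countable _)).2 fun y _ => hatom y
    simp at this
  have hS₁ : ¬ Countable S₁ := by
    intro hc
    have hr : μ₂ (range φ) = 0 := by
      rw [← biUnion_of_singleton (range φ)]
      exact (measure_biUnion_null_iff (countable_range φ)).2 fun y _ => hatom y
    have hr' : NullMeasurableSet (range φ) μ₂ := .of_null hr
    have := h.mp.measure_preimage hr'
    rw [preimage_range, hr] at this
    simp at this
  obtain ⟨Z₁, hZ₁, hZ₁₀, hZ₁c⟩ := exists_uncountable_null (μ₁ := μ₁) hS₁
  obtain ⟨Z₂, hZ₂, hZ₂₀, hZ₂c⟩ := exists_uncountable_null (μ₁ := μ₂) hS₂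
  have h' : AlmostInverse μ₁ μ₂ φ g (N₁ ∪ Z₁ ∪ φ ⁻¹' Z₂) (N₂ ∪ Z₂ ∪ g ⁻¹' Z₁) :=
    { mp := h.mp
      mp_inv := h.mp_inv
      measurableSet₁ := (h.measurableSet₁.union hZ₁).union (h.mp.measurable hZ₂)
      measurableSet₂ := (h.measurableSet₂.union hZ₂).union (h.mp_inv.measurable hZ₁)
      null₁ := measure_union_null (measure_union_null h.null₁ hZ₁₀)
        (h.mp.quasiMeasurePreserving.preimage_null hZ₂₀)
      null₂ := measure_union_null (measure_union_null h.null₂ hZ₂₀)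
        (h.mp_inv.quasiMeasurePreserving.preimage_null hZ₁₀)
      mapsTo := fun x hx => by
        simp only [compl_union, mem_inter_iff, mem_compl_iff, mem_preimage] at hx ⊢
        exact ⟨⟨h.mapsTo hx.1.1, hx.2⟩, by rw [h.invOn.1 hx.1.1]; exact hx.1.2⟩
      mapsTo_inv := fun y hy => by
        simp only [compl_union, mem_inter_iff, mem_compl_iff, mem_preimage] at hy ⊢
        exact ⟨⟨h.mapsTo_inv hy.1.1, hy.2⟩, by rw [h.invOn.2 hy.1.1]; exact hy.1.2⟩
      invOn := h.invOn.mono (compl_subset_compl.2 (by intro x hx; exact .inl (.inl hx)))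
        (compl_subset_compl.2 (by intro x hx; exact .inl (.inl hx))) }
  obtain ⟨e, he⟩ := h'.exists_measurableEquiv
  have := h'.measurableSet₁.standardBorel
  have := h'.measurableSet₂.standardBorel
  let e' : (N₁ ∪ Z₁ ∪ φ ⁻¹' Z₂ : Set S₁) ≃ᵐ (N₂ ∪ Z₂ ∪ g ⁻¹' Z₁ : Set S₂) :=
    PolishSpace.measurableEquivOfNotCountable
      (fun hc => hZ₁c ((countable_coe_iff.1 hc).mono fun x hx => .inl (.inr hx)).to_subtype)
      (fun hc => hZ₂c ((countable_coe_iff.1 hc).mono fun x hx => .inl (.inr hx)).to_subtype)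
  let E : S₁ ≃ᵐ S₂ := (MeasurableEquiv.sumCompl h'.measurableSet₁).symm.trans
    ((e'.sumCongr e).trans (MeasurableEquiv.sumCompl h'.measurableSet₂))
  refine ⟨E, ?_⟩
  filter_upwards [measure_eq_zero_iff_ae_notMem.1 h'.null₁] with x hx
  rw [← he ⟨x, hx⟩]
  change MeasurableEquiv.sumCompl h'.measurableSet₂ (Sum.map e' e
    ((MeasurableEquiv.sumCompl h'.measurableSet₁).symm x)) = _
  have : (MeasurableEquiv.sumCompl h'.measurableSet₁).symm x = Sum.inr ⟨x, hx⟩ :=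
    Equiv.sumCompl_symm_apply_of_neg hx
  rw [this]
  rfl

omit [IsProbabilityMeasure μ₂] in
theorem IsAtomless.measure_singleton [MeasurableSingletonClass S₂] (h : IsAtomless μ₂) (y : S₂) :
    μ₂ {y} = 0 := by
  by_contra hne
  obtain ⟨B, hB, -, h₀, h₁⟩ := h {y} (measurableSet_singleton y) (pos_iff_ne_zero.2 hne)
  rcases subset_singleton_iff_eq.1 hB with rfl | rfl
  · exact h₀ measure_empty
  · exact h₁ rfl

end Borel

/-! ### Consequences of a coupling of Borel spaces -/

section BorelConsequences

variable {S₁ S₂ : Type*} [MeasurableSpace S₁] [MeasurableSpace S₂] [StandardBorelSpace S₁]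
  [StandardBorelSpace S₂] {μ₁ : Measure S₁} {μ₂ : Measure S₂} [IsProbabilityMeasure μ₁]
  [IsProbabilityMeasure μ₂] {W₁ : S₁ → S₁ → ℝ} {W₂ : S₂ → S₂ → ℝ}

omit [StandardBorelSpace S₁] in
theorem HaveCouplingMeasure.isAEPullback (hW₁ : IsKernel μ₁ W₁) (hW₂ : IsKernel μ₂ W₂)
    (h₂ : AlmostTwinFree μ₂ W₂) (h : HaveCouplingMeasure μ₁ W₁ μ₂ W₂) :
    IsAEPullback μ₁ W₁ μ₂ W₂ :=
  h.isAEPullback_prod_unitInterval.of_prod hW₁.measurable hW₂.measurable h₂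

theorem HaveCouplingMeasure.exists_almostInverse (hW₁ : IsKernel μ₁ W₁) (hW₂ : IsKernel μ₂ W₂)
    (h₁ : AlmostTwinFree μ₁ W₁) (h₂ : AlmostTwinFree μ₂ W₂)
    (h : HaveCouplingMeasure μ₁ W₁ μ₂ W₂) :
    ∃ φ g N₁ N₂, AlmostInverse μ₁ μ₂ φ g N₁ N₂ ∧ EqAE μ₁ W₁ (pullback W₂ φ) := by
  obtain ⟨φ, hφ, hW⟩ := h.isAEPullback hW₁ hW₂ h₂
  obtain ⟨C, hC, hC₀, hinj⟩ := h₁.injOn_of_eqAE hW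
  obtain ⟨g, N₁, N₂, hN⟩ := _root_.exists_almostInverse hφ hC hC₀ hinj
  exact ⟨φ, g, N₁, N₂, hN, hW⟩

theorem HaveCouplingMeasure.isRearrangement (hW₁ : IsKernel μ₁ W₁) (hW₂ : IsKernel μ₂ W₂)
    (h₁ : AlmostTwinFree μ₁ W₁) (h₂ : AlmostTwinFree μ₂ W₂) (hatom : ∀ y, μ₂ {y} = 0)
    (h : HaveCouplingMeasure μ₁ W₁ μ₂ W₂) : IsRearrangement μ₁ W₁ μ₂ W₂ := by
  obtain ⟨φ, g, N₁, N₂, hN, hW⟩ := h.exists_almostInverse hW₁ hW₂ h₁ h₂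
  obtain ⟨e, he⟩ := hN.exists_measurableEquiv_ae_eq hatom
  refine ⟨e, ⟨e.measurable, ?_⟩, hW.trans (EqAE.pullback_of_ae_eq W₂ he.symm)⟩
  rw [Measure.map_congr he, hN.mp.map_eq]

end BorelConsequences

/-! ### Lebesgue spaces and their Borel models -/

section Lebesgue

/-- The identity map from a space with its completed σ-field to the space itself. -/
def completionId {X : Type*} [MeasurableSpace X] (ξ : Measure X) : NullMeasurableSpace X ξ → X :=
  fun x => x

theorem measurePreserving_completionId {X : Type*} [MeasurableSpace X] (ξ : Measure X) :
    MeasurePreserving (completionId ξ) ξ.completion ξ := by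
  have hm : Measurable (completionId ξ) := fun s hs => MeasurableSet.nullMeasurableSet (s := s) hs
  refine ⟨hm, ?_⟩
  ext s hs
  rw [Measure.map_apply hm hs]
  rfl

instance isProbabilityMeasure_completion {X : Type*} [MeasurableSpace X] (ξ : Measure X)
    [IsProbabilityMeasure ξ] : IsProbabilityMeasure ξ.completion :=
  ⟨measure_univ (μ := ξ)⟩

/-- The bijection `e` identifies the σ-field of `S` with the completion of that of `T` for `ν`, and
`μ` with `ν`. For a Lebesgue space `S` the model `T` is a Borel space; keeping it as a separate type
avoids two σ-fields on one type. -/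
structure IsCompletionOf {S T : Type*} [MeasurableSpace S] [MeasurableSpace T] (μ : Measure S)
    (ν : Measure T) (e : S ≃ T) : Prop where
  mp : MeasurePreserving e μ ν
  measurableSet_iff : ∀ s : Set S, MeasurableSet s ↔ NullMeasurableSet (e.symm ⁻¹' s) ν

theorem IsLebesgueSpace.exists_isCompletionOf {S : Type u} [m : MeasurableSpace S] {μ : Measure S}
    (h : IsLebesgueSpace μ) :
    ∃ (T : Type u) (_ : MeasurableSpace T) (_ : StandardBorelSpace T) (ν : Measure T) (e : S ≃ T),
      IsCompletionOf μ ν e := by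
  obtain ⟨m₀, hle, hstd, hiff⟩ := h
  have hm : @Measurable S S m m₀ id := fun s hs => hle s hs
  have hmp : @MeasurePreserving S S m m₀ id μ (μ.trim hle) := by
    refine @MeasurePreserving.mk S S m m₀ id μ _ hm (@Measure.ext S m₀ _ _ fun s hs => ?_)
    rw [trim_measurableSet_eq hle hs]
    exact @Measure.map_apply S S m m₀ μ id hm s hs
  exact ⟨S, m₀, hstd, μ.trim hle, Equiv.refl S, @IsCompletionOf.mk S S m m₀ μ _ _ hmp hiff⟩

namespace IsCompletionOf

variable {S T X : Type*} [MeasurableSpace S] [MeasurableSpace T] [MeasurableSpace X]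
  {μ : Measure S} {ν : Measure T} {e : S ≃ T} {ξ : Measure X}

theorem isComplete (h : IsCompletionOf μ ν e) : μ.IsComplete := by
  refine ⟨fun s hs => ?_⟩
  obtain ⟨t, hst, ht, ht₀⟩ := exists_measurable_superset_of_null hs
  refine (h.measurableSet_iff s).2 (.of_null ?_)
  have := h.mp.measure_preimage ((h.measurableSet_iff t).1 ht)
  rw [← preimage_comp, e.symm_comp_self, preimage_id, ht₀] at this
  exact measure_mono_null (preimage_mono hst) this.symm

/-- Every measurable set of `S` differs from a measurable set of `T` by a null set, so on a complete
space measurability into `T` already gives measurability into `S`. -/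
theorem measurePreserving_symm_comp (h : IsCompletionOf μ ν e) [ξ.IsComplete] {φ : X → T}
    (hφ : MeasurePreserving φ ξ ν) : MeasurePreserving (e.symm ∘ φ) ξ μ := by
  have hm : Measurable (e.symm ∘ φ) := fun s hs =>
    (((h.measurableSet_iff s).1 hs).preimage
      hφ.quasiMeasurePreserving).measurable_of_complete
  refine ⟨hm, ?_⟩
  ext s hs
  have hs' := (h.measurableSet_iff s).1 hs
  rw [Measure.map_apply hm hs, preimage_comp, hφ.measure_preimage hs', ← h.mp.measure_preimage hs',
    ← preimage_comp, e.symm_comp_self, preimage_id]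

/-- The same for a map on a space that is not complete, after completing it. -/
theorem measurePreserving_symm_comp_completion (h : IsCompletionOf μ ν e) {φ : X → T}
    (hφ : MeasurePreserving φ ξ ν) :
    MeasurePreserving (e.symm ∘ φ ∘ completionId ξ) ξ.completion μ :=
  h.measurePreserving_symm_comp (hφ.comp (measurePreserving_completionId ξ))

theorem measurableSingletonClass [MeasurableSingletonClass T] (h : IsCompletionOf μ ν e) :
    MeasurableSingletonClass S := by
  refine ⟨fun x => (h.measurableSet_iff _).2 ?_⟩
  have : e.symm ⁻¹' {x} = {e x} := by
    ext y
    simp [Equiv.symm_apply_eq]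
  rw [this]
  exact (measurableSet_singleton _).nullMeasurableSet

/-- A kernel on a Lebesgue space is a.e. equal to one that is measurable for the Borel σ-field. The
product of two completed σ-fields is contained in the completion of the product. -/
theorem exists_isKernel [IsProbabilityMeasure μ] [IsProbabilityMeasure ν]
    (h : IsCompletionOf μ ν e) {W : S → S → ℝ} (hW : IsKernel μ W) :
    ∃ V : T → T → ℝ, IsKernel ν V ∧ EqAE ν (pullback W e.symm) V := by
  have hfst := h.measurePreserving_symm_comp_completion
    (measurePreserving_fst (μ := ν) (ν := ν))
  have hsnd := h.measurePreserving_symm_comp_completion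
    (measurePreserving_snd (μ := ν) (ν := ν))
  have hnull : NullMeasurable (fun p : T × T => W (e.symm p.1) (e.symm p.2)) (ν.prod ν) :=
    hW.measurable.comp (hfst.measurable.prodMk hsnd.measurable)
  obtain ⟨V₀, hV₀, hWV⟩ := hnull.aemeasurable
  have hswap := (Measure.measurePreserving_swap (μ := ν) (ν := ν)).quasiMeasurePreserving.ae hWV
  let V : T → T → ℝ := fun x y => max 0 ((V₀ (x, y) + V₀ (y, x)) / 2)
  have hV : Measurable (Function.uncurry V) :=
    measurable_const.max ((hV₀.add (hV₀.comp measurable_swap)).div_const 2)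
  have hEq : EqAE ν (pullback W e.symm) V := by
    filter_upwards [hWV, hswap] with p hp hp'
    simp only [Prod.fst_swap, Prod.snd_swap] at hp'
    have hp'' : V₀ (p.2, p.1) = V₀ (p.1, p.2) := by
      rw [← hp, ← Prod.swap, ← hp', hW.symm]
    simp only [pullback, V]
    rw [hp'', ← hp, add_self_div_two, max_eq_right (hW.nonneg _ _)]
  refine ⟨V, ⟨hV, ?_, fun x y => ?_, fun x y => le_max_left _ _⟩, hEq⟩
  · rw [← (h.mp.prod h.mp).integrable_comp hV.aestronglyMeasurable]
    refine hW.integrable.congr ?_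
    filter_upwards [hEq.comp_measurePreserving h.mp] with p hp
    change W p.1 p.2 = V (e p.1) (e p.2)
    simpa [pullback] using hp
  · simp only [V, add_comm]

theorem eqAE_pullback [SFinite μ] [SFinite ν] (h : IsCompletionOf μ ν e) {W : S → S → ℝ}
    {V : T → T → ℝ} (hWV : EqAE ν (pullback W e.symm) V) : EqAE μ W (pullback V e) := by
  filter_upwards [hWV.comp_measurePreserving h.mp] with p hp
  simpa [pullback] using hp

theorem almostTwinFree [IsProbabilityMeasure ν] (h : IsCompletionOf μ ν e) {W : S → S → ℝ}
    {V : T → T → ℝ} (hWV : EqAE ν (pullback W e.symm) V) (htf : AlmostTwinFree μ W) :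
    AlmostTwinFree ν V := by
  obtain ⟨N, hN, htf⟩ := htf
  have := h.isComplete
  have hN' : ∀ᵐ x ∂ν, e.symm x ∉ N := by
    rw [ae_iff]
    simp only [not_not]
    have := h.mp.measure_preimage ((h.measurableSet_iff N).1 (measurableSet_of_null hN))
    rw [← preimage_comp, e.symm_comp_self, preimage_id, hN] at this
    exact this.symm
  have hgood : ∀ᵐ x ∂ν, e.symm x ∉ N ∧ ∀ᵐ y ∂ν, W (e.symm x) (e.symm y) = V x y :=
    hN'.and (Measure.ae_ae_of_ae_prod hWV)
  refine ⟨_, ae_iff.1 hgood, ?_⟩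
  rintro ⟨x, x', hx, hx', hne, htw⟩
  have hx := not_not.1 hx
  have hx' := not_not.1 hx'
  refine htf ⟨e.symm x, e.symm x', hx.1, hx'.1, e.symm.injective.ne hne, ?_⟩
  have hT : ∀ᵐ y ∂ν, W (e.symm x) (e.symm y) = W (e.symm x') (e.symm y) := by
    filter_upwards [hx.2, hx'.2, htw] with y h₁ h₂ h₃
    rw [h₁, h₂, h₃]
  filter_upwards [h.mp.quasiMeasurePreserving.ae hT] with y hy
  simpa using hy

variable {S₁ S₂ T₁ T₂ : Type*} [MeasurableSpace S₁] [MeasurableSpace S₂] [MeasurableSpace T₁]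
  [MeasurableSpace T₂] {μ₁ : Measure S₁} {μ₂ : Measure S₂} {ν₁ : Measure T₁} {ν₂ : Measure T₂}
  {e₁ : S₁ ≃ T₁} {e₂ : S₂ ≃ T₂}

theorem measurePreserving_conj (h₁ : IsCompletionOf μ₁ ν₁ e₁) (h₂ : IsCompletionOf μ₂ ν₂ e₂)
    {φ : T₁ → T₂} (hφ : MeasurePreserving φ ν₁ ν₂) :
    MeasurePreserving (e₂.symm ∘ φ ∘ e₁) μ₁ μ₂ :=
  have := h₁.isComplete
  h₂.measurePreserving_symm_comp (hφ.comp h₁.mp)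

theorem almostInverse_conj (h₁ : IsCompletionOf μ₁ ν₁ e₁) (h₂ : IsCompletionOf μ₂ ν₂ e₂)
    {φ : T₁ → T₂} {g : T₂ → T₁} {N₁ : Set T₁} {N₂ : Set T₂}
    (h : AlmostInverse ν₁ ν₂ φ g N₁ N₂) :
    AlmostInverse μ₁ μ₂ (e₂.symm ∘ φ ∘ e₁) (e₁.symm ∘ g ∘ e₂) (e₁ ⁻¹' N₁) (e₂ ⁻¹' N₂) where
  mp := h₁.measurePreserving_conj h₂ h.mp
  mp_inv := h₂.measurePreserving_conj h₁ h.mp_inv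
  measurableSet₁ := h₁.mp.measurable h.measurableSet₁
  measurableSet₂ := h₂.mp.measurable h.measurableSet₂
  null₁ := h₁.mp.quasiMeasurePreserving.preimage_null h.null₁
  null₂ := h₂.mp.quasiMeasurePreserving.preimage_null h.null₂
  mapsTo x hx := by simpa using! h.mapsTo hx
  mapsTo_inv y hy := by simpa using! h.mapsTo_inv hy
  invOn := ⟨fun x hx => by simpa [Equiv.symm_apply_eq] using! h.invOn.1 hx,
    fun y hy => by simpa [Equiv.symm_apply_eq] using! h.invOn.2 hy⟩

omit [MeasurableSpace S₂] in
/-- An a.e. identity between Borel kernels on the models becomes one between the original kernels,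
with `φ` conjugated to a map of `S₁` to `S₂`. -/
theorem eqAE_conj [SFinite μ₁] [SFinite ν₁] [SFinite ν₂]
    (h₁ : IsCompletionOf μ₁ ν₁ e₁) {W₁ : S₁ → S₁ → ℝ}
    {W₂ : S₂ → S₂ → ℝ} {V₁ : T₁ → T₁ → ℝ} {V₂ : T₂ → T₂ → ℝ}
    (hWV₁ : EqAE ν₁ (pullback W₁ e₁.symm) V₁) (hWV₂ : EqAE ν₂ (pullback W₂ e₂.symm) V₂)
    {φ : T₁ → T₂} (hφ : MeasurePreserving φ ν₁ ν₂) (h : EqAE ν₁ V₁ (pullback V₂ φ)) :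
    EqAE μ₁ W₁ (pullback W₂ (e₂.symm ∘ φ ∘ e₁)) :=
  ((h₁.eqAE_pullback hWV₁).trans (h.comp_measurePreserving h₁.mp)).trans
    (hWV₂.comp_measurePreserving (hφ.comp h₁.mp)).symm

theorem isAEPullback_conj [SFinite μ₁] [SFinite ν₁] [SFinite ν₂]
    (h₁ : IsCompletionOf μ₁ ν₁ e₁) (h₂ : IsCompletionOf μ₂ ν₂ e₂) {W₁ : S₁ → S₁ → ℝ}
    {W₂ : S₂ → S₂ → ℝ} {V₁ : T₁ → T₁ → ℝ} {V₂ : T₂ → T₂ → ℝ}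
    (hWV₁ : EqAE ν₁ (pullback W₁ e₁.symm) V₁) (hWV₂ : EqAE ν₂ (pullback W₂ e₂.symm) V₂)
    (h : IsAEPullback ν₁ V₁ ν₂ V₂) : IsAEPullback μ₁ W₁ μ₂ W₂ := by
  obtain ⟨φ, hφ, h⟩ := h
  have hW := h₁.eqAE_conj hWV₁ hWV₂ hφ h
  exact ⟨_, h₁.measurePreserving_conj h₂ hφ, hW⟩

theorem isRearrangement_conj [SFinite μ₁] [SFinite ν₁] [SFinite ν₂]
    (h₁ : IsCompletionOf μ₁ ν₁ e₁) (h₂ : IsCompletionOf μ₂ ν₂ e₂) {W₁ : S₁ → S₁ → ℝ}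
    {W₂ : S₂ → S₂ → ℝ} {V₁ : T₁ → T₁ → ℝ} {V₂ : T₂ → T₂ → ℝ}
    (hWV₁ : EqAE ν₁ (pullback W₁ e₁.symm) V₁) (hWV₂ : EqAE ν₂ (pullback W₂ e₂.symm) V₂)
    (h : IsRearrangement ν₁ V₁ ν₂ V₂) : IsRearrangement μ₁ W₁ μ₂ W₂ := by
  obtain ⟨φ, hφ, h⟩ := h
  have hW := h₁.eqAE_conj hWV₁ hWV₂ hφ h
  exact ⟨⟨e₁.trans (φ.toEquiv.trans e₂.symm), (h₁.measurePreserving_conj h₂ hφ).measurable,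
    (h₂.measurePreserving_conj h₁ (hφ.symm φ)).measurable⟩,
    h₁.measurePreserving_conj h₂ hφ, hW⟩

theorem haveCommonPullbackOn_completion [SFinite ν₁] [SFinite ν₂]
    (h₁ : IsCompletionOf μ₁ ν₁ e₁) (h₂ : IsCompletionOf μ₂ ν₂ e₂) {W₁ : S₁ → S₁ → ℝ}
    {W₂ : S₂ → S₂ → ℝ} {V₁ : T₁ → T₁ → ℝ} {V₂ : T₂ → T₂ → ℝ}
    (hWV₁ : EqAE ν₁ (pullback W₁ e₁.symm) V₁) (hWV₂ : EqAE ν₂ (pullback W₂ e₂.symm) V₂)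
    [IsProbabilityMeasure ξ] (h : HaveCommonPullbackOn ξ ν₁ V₁ ν₂ V₂) :
    HaveCommonPullbackOn ξ.completion μ₁ W₁ μ₂ W₂ := by
  obtain ⟨φ₁, φ₂, hφ₁, hφ₂, h⟩ := h
  refine ⟨_, _, h₁.measurePreserving_symm_comp_completion hφ₁,
    h₂.measurePreserving_symm_comp_completion hφ₂, ?_⟩
  have := ((hWV₁.comp_measurePreserving hφ₁).trans h).trans
    (hWV₂.comp_measurePreserving hφ₂).symm
  exact this.comp_measurePreserving (measurePreserving_completionId ξ)

theorem isAEPullback_completedFst [IsProbabilityMeasure μ₁] [IsProbabilityMeasure ν₁] [SFinite ν₂]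
    (h₁ : IsCompletionOf μ₁ ν₁ e₁) (h₂ : IsCompletionOf μ₂ ν₂ e₂) {W₁ : S₁ → S₁ → ℝ}
    {W₂ : S₂ → S₂ → ℝ} {V₁ : T₁ → T₁ → ℝ} {V₂ : T₂ → T₂ → ℝ}
    (hWV₁ : EqAE ν₁ (pullback W₁ e₁.symm) V₁) (hWV₂ : EqAE ν₂ (pullback W₂ e₂.symm) V₂)
    (h : IsAEPullback (ν₁.prod (volume : Measure I)) (pullback V₁ Prod.fst) ν₂ V₂) :
    IsAEPullback (μ₁.prod (volume : Measure I)).completion (pullback W₁ (completedFst μ₁))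
      μ₂ W₂ := by
  obtain ⟨ψ, hψ, h⟩ := h
  have he : MeasurePreserving (Prod.map e₁ id) (μ₁.prod (volume : Measure I))
      (ν₁.prod volume) := h₁.mp.prod (MeasurePreserving.id _)
  refine ⟨_, h₂.measurePreserving_symm_comp_completion (hψ.comp he), ?_⟩
  have hfst : MeasurePreserving Prod.fst (μ₁.prod (volume : Measure I)) μ₁ :=
    measurePreserving_fst
  have := (((h₁.eqAE_pullback hWV₁).comp_measurePreserving hfst).trans
    (h.comp_measurePreserving he)).trans (hWV₂.comp_measurePreserving (hψ.comp he)).symm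
  exact this.comp_measurePreserving (measurePreserving_completionId _)

end IsCompletionOf

theorem measurePreserving_completedFst {S : Type*} [MeasurableSpace S] (μ : Measure S)
    [IsProbabilityMeasure μ] :
    MeasurePreserving (completedFst μ) (μ.prod (volume : Measure I)).completion μ := by
  have hfst : MeasurePreserving Prod.fst (μ.prod (volume : Measure I)) μ := measurePreserving_fst
  exact hfst.comp (measurePreserving_completionId (μ.prod (volume : Measure I)))

end Lebesgue

/-! ### The equivalences -/

theorem theorem8p3 {S₁ : Type u} {S₂ : Type v} [MeasurableSpace S₁] [MeasurableSpace S₂]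
    (μ₁ : Measure S₁) (μ₂ : Measure S₂) [IsProbabilityMeasure μ₁] [IsProbabilityMeasure μ₂]
    (W₁ : S₁ → S₁ → ℝ) (W₂ : S₂ → S₂ → ℝ) (hW₁ : IsKernel μ₁ W₁) (hW₂ : IsKernel μ₂ W₂) :
    -- Borel spaces
    (StandardBorelSpace S₁ → StandardBorelSpace S₂ →
      List.TFAE [
        KernelEquiv μ₁ W₁ μ₂ W₂,
        ∃ c : Coupling μ₁ μ₂, EqAE c.P (pullback W₁ c.φ₁) (pullback W₂ c.φ₂),
        HaveCommonPullbackOn (volume : Measure I) μ₁ W₁ μ₂ W₂,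
        IsAEPullback (μ₁.prod (volume : Measure I)) (pullback W₁ Prod.fst) μ₂ W₂,
        ∃ μ : Measure (S₁ × S₂), IsProbabilityMeasure μ ∧
          μ.map Prod.fst = μ₁ ∧ μ.map Prod.snd = μ₂ ∧
          EqAE μ (pullback W₁ Prod.fst) (pullback W₂ Prod.snd)] ∧
      (AlmostTwinFree μ₂ W₂ →
        (KernelEquiv μ₁ W₁ μ₂ W₂ ↔ IsAEPullback μ₁ W₁ μ₂ W₂)) ∧
      (AlmostTwinFree μ₁ W₁ → AlmostTwinFree μ₂ W₂ →
        (KernelEquiv μ₁ W₁ μ₂ W₂ ↔ IsAlmostBijectiveRearrangement μ₁ W₁ μ₂ W₂) ∧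
        (IsAtomless μ₂ →
          List.TFAE [
            KernelEquiv μ₁ W₁ μ₂ W₂,
            IsRearrangement μ₁ W₁ μ₂ W₂,
            IsRearrangement μ₂ W₂ μ₁ W₁]))) ∧
    -- Lebesgue spaces
    (IsLebesgueSpace μ₁ → IsLebesgueSpace μ₂ →
      List.TFAE [
        KernelEquiv μ₁ W₁ μ₂ W₂,
        ∃ c : Coupling μ₁ μ₂, EqAE c.P (pullback W₁ c.φ₁) (pullback W₂ c.φ₂),
        HaveCommonPullbackOn (volume : Measure I).completion μ₁ W₁ μ₂ W₂,
        IsAEPullback (μ₁.prod (volume : Measure I)).completion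
          (pullback W₁ (completedFst μ₁)) μ₂ W₂,
        ∃ μ : Measure (S₁ × S₂), IsProbabilityMeasure μ ∧
          μ.map Prod.fst = μ₁ ∧ μ.map Prod.snd = μ₂ ∧
          EqAE μ (pullback W₁ Prod.fst) (pullback W₂ Prod.snd)] ∧
      (AlmostTwinFree μ₂ W₂ →
        (KernelEquiv μ₁ W₁ μ₂ W₂ ↔ IsAEPullback μ₁ W₁ μ₂ W₂)) ∧
      (AlmostTwinFree μ₁ W₁ → AlmostTwinFree μ₂ W₂ →
        (KernelEquiv μ₁ W₁ μ₂ W₂ ↔ IsAlmostBijectiveRearrangement μ₁ W₁ μ₂ W₂) ∧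
        (IsAtomless μ₂ →
          List.TFAE [
            KernelEquiv μ₁ W₁ μ₂ W₂,
            IsRearrangement μ₁ W₁ μ₂ W₂,
            IsRearrangement μ₂ W₂ μ₁ W₁]))) := by
  have m₁ := hW₁.measurable
  have m₂ := hW₂.measurable
  -- These implications hold for arbitrary probability spaces, Borel and Lebesgue alike.
  have coupling_of_measure : HaveCouplingMeasure μ₁ W₁ μ₂ W₂ →
      ∃ c : Coupling μ₁ μ₂, EqAE c.P (pullback W₁ c.φ₁) (pullback W₂ c.φ₂) :=
    fun h => h.exists_coupling
  have equiv_of_coupling : (∃ c : Coupling μ₁ μ₂, EqAE c.P (pullback W₁ c.φ₁) (pullback W₂ c.φ₂)) →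
      KernelEquiv μ₁ W₁ μ₂ W₂ := kernelEquiv_of_exists_coupling
  have equiv_of_pullback : IsAEPullback μ₁ W₁ μ₂ W₂ → KernelEquiv μ₁ W₁ μ₂ W₂ :=
    fun h => h.kernelEquiv m₁ m₂
  have rearrangement_tfae : [KernelEquiv μ₁ W₁ μ₂ W₂, IsRearrangement μ₁ W₁ μ₂ W₂,
      IsRearrangement μ₂ W₂ μ₁ W₁].TFAE ↔
      (KernelEquiv μ₁ W₁ μ₂ W₂ → IsRearrangement μ₁ W₁ μ₂ W₂) := by
    refine ⟨fun h => (h.out 0 1).1, fun h => ?_⟩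
    tfae_have 1 → 2 := h
    tfae_have 2 → 3 := fun h => h.symm
    tfae_have 3 → 2 := fun h => h.symm
    tfae_have 2 → 1 := fun h => equiv_of_pullback h.isAEPullback
    tfae_finish
  refine ⟨fun hS₁ hS₂ => ?_, fun hL₁ hL₂ => ?_⟩
  · have measure_of_equiv : KernelEquiv μ₁ W₁ μ₂ W₂ → HaveCouplingMeasure μ₁ W₁ μ₂ W₂ := fun h =>
      h.haveCouplingMeasure hW₁ hW₂ (MeasurePreserving.id μ₁) (MeasurePreserving.id μ₂)
        (ae_of_all _ fun _ => rfl) (ae_of_all _ fun _ => rfl)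
    refine ⟨?_, fun tf₂ => ⟨fun h => (measure_of_equiv h).isAEPullback hW₁ hW₂ tf₂,
      equiv_of_pullback⟩, fun tf₁ tf₂ =>
      ⟨⟨fun h => ?_, fun h => equiv_of_pullback h.isAEPullback⟩, fun ha =>
        rearrangement_tfae.2 fun h =>
        (measure_of_equiv h).isRearrangement hW₁ hW₂ tf₁ tf₂ ha.measure_singleton⟩⟩
    · tfae_have 1 → 5 := measure_of_equiv
      tfae_have 5 → 2 := coupling_of_measure
      tfae_have 2 → 1 := equiv_of_coupling
      tfae_have 5 → 3 := fun h => HaveCouplingMeasure.haveCommonPullbackOn_unitInterval h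
      tfae_have 3 → 5 := fun h => h.haveCouplingMeasure m₁ m₂
      tfae_have 5 → 4 := fun h => HaveCouplingMeasure.isAEPullback_prod_unitInterval h
      tfae_have 4 → 5 := fun h =>
        (h.haveCommonPullbackOn measurePreserving_fst).haveCouplingMeasure m₁ m₂
      tfae_finish
    · obtain ⟨φ, g, N₁, N₂, hN, hW⟩ := (measure_of_equiv h).exists_almostInverse hW₁ hW₂ tf₁ tf₂
      exact hN.isAlmostBijectiveRearrangement hW
  · obtain ⟨T₁, _, _, ν₁, e₁, c₁⟩ := hL₁.exists_isCompletionOf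
    obtain ⟨T₂, _, _, ν₂, e₂, c₂⟩ := hL₂.exists_isCompletionOf
    have : IsProbabilityMeasure ν₁ := c₁.mp.map_eq ▸
      Measure.isProbabilityMeasure_map c₁.mp.measurable.aemeasurable
    have : IsProbabilityMeasure ν₂ := c₂.mp.map_eq ▸
      Measure.isProbabilityMeasure_map c₂.mp.measurable.aemeasurable
    obtain ⟨V₁, hV₁, hWV₁⟩ := c₁.exists_isKernel hW₁
    obtain ⟨V₂, hV₂, hWV₂⟩ := c₂.exists_isKernel hW₂
    have measure_of_equiv : KernelEquiv μ₁ W₁ μ₂ W₂ → HaveCouplingMeasure ν₁ V₁ ν₂ V₂ := fun h =>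
      h.haveCouplingMeasure hV₁ hV₂ c₁.mp c₂.mp (c₁.eqAE_pullback hWV₁) (c₂.eqAE_pullback hWV₂)
    refine ⟨?_, fun tf₂ => ⟨fun h => ?_, equiv_of_pullback⟩, fun tf₁ tf₂ =>
      ⟨⟨fun h => ?_, fun h => equiv_of_pullback h.isAEPullback⟩, fun ha =>
        rearrangement_tfae.2 fun h => ?_⟩⟩
    · tfae_have 1 → 3 := fun h => c₁.haveCommonPullbackOn_completion c₂ hWV₁ hWV₂
        (measure_of_equiv h).haveCommonPullbackOn_unitInterval
      tfae_have 1 → 4 := fun h => c₁.isAEPullback_completedFst c₂ hWV₁ hWV₂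
        (measure_of_equiv h).isAEPullback_prod_unitInterval
      tfae_have 3 → 5 := fun h => h.haveCouplingMeasure m₁ m₂
      tfae_have 4 → 5 := fun h => (h.haveCommonPullbackOn
        (measurePreserving_completedFst μ₁)).haveCouplingMeasure m₁ m₂
      tfae_have 5 → 2 := coupling_of_measure
      tfae_have 2 → 1 := equiv_of_coupling
      tfae_finish
    · exact c₁.isAEPullback_conj c₂ hWV₁ hWV₂
        ((measure_of_equiv h).isAEPullback hV₁ hV₂ (c₂.almostTwinFree hWV₂ tf₂))
    · obtain ⟨φ, g, N₁, N₂, hN, hV⟩ := (measure_of_equiv h).exists_almostInverse hV₁ hV₂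
        (c₁.almostTwinFree hWV₁ tf₁) (c₂.almostTwinFree hWV₂ tf₂)
      exact (c₁.almostInverse_conj c₂ hN).isAlmostBijectiveRearrangement
        (c₁.eqAE_conj hWV₁ hWV₂ hN.mp hV)
    · have := c₂.measurableSingletonClass
      have hatom : ∀ y, ν₂ {y} = 0 := by
        intro y
        rw [← c₂.mp.measure_preimage (measurableSet_singleton y).nullMeasurableSet,
          show e₂ ⁻¹' {y} = {e₂.symm y} from by ext x; simp [Equiv.eq_symm_apply]]
        exact ha.measure_singleton _
      exact c₁.isRearrangement_conj c₂ hWV₁ hWV₂ ((measure_of_equiv h).isRearrangement hV₁ hV₂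
        (c₁.almostTwinFree hWV₁ tf₁) (c₂.almostTwinFree hWV₂ tf₂) hatom)
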